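/- Let $d\ge 1$, and let $R(\mathbf x)=\mathbf x^{T}M\mathbf x$ be a non-degenerate quadratic form in $d$ variables, where $M$ is a symmetric integer $d\times d$ matrix with $\det M\neq 0$. Let $\eta:\mathbb R^d\to[0,1]$ be a Schwartz function with $\eta=1$ on $[-1,1]^d$ and $\eta=0$ outside $[-2,2]^d$. For an integer $N\ge 1$ put $\omega=\eta(\cdot/N)$, and for $\alpha\in\mathbb R$, $\boldsymbol\theta\in\mathbb R^d$ let $$F_R(\alpha,\boldsymbol\theta)=\sum_{\mathbf n\in\mathbb Z^d}\omega(\mathbf n)\,e\big(\alpha R(\mathbf n)+\boldsymbol\theta\cdot\mathbf n\big),\qquad e(x)=e^{2\pi i x}.$$ Write $\|\beta\|$ for the distance from $\beta\in\mathbb R$ to the nearest integer. Then for all $c_1,c_2>0$ and every $\varepsilon>0$ there is a constant $C>0$, depending only on $d,R,\eta,c_1,c_2,\varepsilon$, such that the following holds for every integer $N\ge1$. If $\alpha=\frac aq+\beta$ with $a,q\in\mathbb Z$, $\beta\in\mathbb R$, $(a,q)=1$, $1\le q\le c_1N$ and $\|\beta\|\le \frac{c_2}{qN}$, then for all $\boldsymbol\theta\in\mathbb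 R^d$ $$|F_R(\alpha,\boldsymbol\theta)|\le C\,q^{-d/2+\varepsilon}\min\big(N^d,\|\beta\|^{-d/2}\big),$$ where the minimum is read as $N^d$ when $\|\beta\|=0$. -/

import Mathlib

open scoped SchwartzMap Matrix

noncomputable section

/-- The distance from a real number to the nearest integer. -/
def distInt (x : ℝ) : ℝ := |x - round x|

/-- `[-1,1]^d ≺ η ≺ [-2,2]^d`: the Schwartz function `η` takes values in `[0,1]`,
equals `1` on the cube `[-1,1]^d` and vanishes outside the cube `[-2,2]^d`. -/
structure IsCubeCutoff {d : ℕ} (η : 𝓢(EuclideanSpace ℝ (Fin d), ℝ)) : Prop where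
  nonneg : ∀ x, 0 ≤ η x
  le_one : ∀ x, η x ≤ 1
  eq_one : ∀ x, (∀ i, |x i| ≤ 1) → η x = 1
  eq_zero : ∀ x, (∃ i, 2 < |x i|) → η x = 0

/-- The weight `ω = η(· / N)`, evaluated at an integer point. -/
def cutoffWeight {d : ℕ} (η : 𝓢(EuclideanSpace ℝ (Fin d), ℝ)) (N : ℕ) (n : Fin d → ℤ) : ℝ :=
  η (WithLp.toLp 2 fun i => (n i : ℝ) / (N : ℝ))

/-- The integral quadratic form `R(n) = nᵀ M n` with matrix `M`. -/
def quadValue {d : ℕ} (M : Matrix (Fin d) (Fin d) ℤ) (n : Fin d → ℤ) : ℤ :=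
  n ⬝ᵥ (M *ᵥ n)

/-- The smoothed quadratic exponential sum
`F_R(α, θ) = ∑ n ∈ ℤ^d, ω(n) e(α R(n) + θ · n)`, where `e(x) = exp(2πix)`.
Only finitely many terms are nonzero when `η` is a cube cutoff and `N ≥ 1`. -/
def quadExpSum {d : ℕ} (M : Matrix (Fin d) (Fin d) ℤ) (η : 𝓢(EuclideanSpace ℝ (Fin d), ℝ))
    (N : ℕ) (α : ℝ) (θ : Fin d → ℝ) : ℂ :=
  ∑' n : Fin d → ℤ, (cutoffWeight η N n : ℂ) *
    Complex.exp (2 * Real.pi * Complex.I *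
      ((α * (quadValue M n : ℝ) + ∑ i, θ i * (n i : ℝ) : ℝ) : ℂ))

/-- `min(N^d, t^{-d/2})` for `t ≥ 0`, where `0^{-d/2} = +∞`, so that the value at `t = 0`
is `N^d`. -/
def arcMin (d N : ℕ) (t : ℝ) : ℝ :=
  if t = 0 then (N : ℝ) ^ d else min ((N : ℝ) ^ d) (t ^ (-(d : ℝ) / 2))

end

open scoped FourierTransform

/-! ### Iterated differences and derivatives -/

/-! Weyl differencing turns `|F|²` into a sum over shifts `h` of linear exponential sums with
frequency `2αMh`; `θ` and `R(h)` survive only in a unimodular factor (`norm_quadExpSum_sq_le`). The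
smooth weight makes each linear sum `≪ N^d ∏ 1/(1+(N‖ξᵢ‖)²)` by repeated summation by parts
(`exists_norm_linExpSum_cutoff_le`). Since `det M ≠ 0`, `h ↦ 2Mh` is injective, so `|F|² ≪ N^d T^d`
with `T = ∑_{|l| ≤ KN} 1/(1+(N‖αl‖)²)` (`exists_norm_quadExpSum_sq_le`).

It remains to show `T ≪ min(N/q, 1/(qN‖β‖))` (`exists_sum_distDecay_le`). Write `l = qj + s` and let
`r` be the least absolute residue of `as` mod `q`. The perturbation of `as/q` coming from `β` is
`O(1/q)`, so only boundedly many `r` can give a small `‖αl‖`; the others sum with weight `1/r²`. The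
smooth weight avoids logarithms and divisor bounds, so the exponent `-d/2` is reached without loss,
and `ε` enters only by weakening at the end. -/

lemma norm_fwdDiff_iterate_le {E : Type*} [NormedAddCommGroup E] [NormedSpace ℝ E] (v : E) (C : ℝ)
    (k : ℕ) (f : E → ℝ) (hf : ContDiff ℝ k f) (hC : ∀ x, ‖iteratedFDeriv ℝ k f x‖ ≤ C) (x : E) :
    ‖(fwdDiff v)^[k] f x‖ ≤ C * ‖v‖ ^ k := by
  induction k generalizing f C with
  | zero => simpa using hC x
  | succ k ih =>
    have hk : ContDiff ℝ k f := hf.of_le (by exact_mod_cast k.le_succ)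
    have hk' : ContDiff ℝ k fun x => f (x + v) := hk.comp (by fun_prop)
    rw [Function.iterate_succ_apply]
    -- By the mean value inequality, one difference trades one derivative for a factor `‖v‖`.
    refine (ih (C * ‖v‖) (fwdDiff v f) (hk'.sub hk) fun y => ?_).trans (le_of_eq (by ring))
    have h1 : iteratedFDeriv ℝ k (fwdDiff v f) y
        = iteratedFDeriv ℝ k f (y + v) - iteratedFDeriv ℝ k f y := by
      have : fwdDiff v f = (fun x => f (x + v)) - f := rfl
      rw [this, iteratedFDeriv_sub_apply hk'.contDiffAt hk.contDiffAt, iteratedFDeriv_comp_add_right]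
    rw [h1]
    have hd : Differentiable ℝ (iteratedFDeriv ℝ k f) :=
      hf.differentiable_iteratedFDeriv (by exact_mod_cast k.lt_succ_self)
    have := Convex.norm_image_sub_le_of_norm_fderiv_le (𝕜 := ℝ) (s := Set.univ) (x := y) (y := y + v)
      (C := C) (fun x _ => hd x) (fun x _ => by rw [norm_fderiv_iteratedFDeriv]; exact hC x)
      convex_univ trivial trivial
    simpa using this

/-- Leibniz and translation-invariant sup bounds on the derivatives; uniformity in `y` is what later
makes the estimate uniform in the Weyl shift. -/
lemma exists_norm_iteratedFDeriv_mul_translate_le {E : Type*} [NormedAddCommGroup E]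
    [NormedSpace ℝ E] (η : 𝓢(E, ℝ)) (k : ℕ) :
    ∃ C : ℝ, 0 ≤ C ∧ ∀ y x, ‖iteratedFDeriv ℝ k (fun x => η (x + y) * η x) x‖ ≤ C := by
  choose B hB using fun i => η.decay 0 i
  simp only [pow_zero, one_mul] at hB
  refine ⟨∑ i ∈ Finset.range (k + 1), (k.choose i : ℝ) * B i * B (k - i),
    Finset.sum_nonneg fun i _ => mul_nonneg (mul_nonneg (by positivity) (hB i).1.le) (hB _).1.le,
    fun y x => ?_⟩
  have h1 : ContDiff ℝ k fun x => η (x + y) := (η.smooth k).comp (by fun_prop)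
  refine (norm_iteratedFDeriv_mul_le h1 (η.smooth k) x le_rfl).trans ?_
  refine Finset.sum_le_sum fun i _ => ?_
  rw [iteratedFDeriv_comp_add_right]
  have := (hB i).1
  gcongr
  · exact (hB i).2 _
  · exact (hB _).2 _

/-! ### Exponential sums with compactly supported weights -/

/-- The cube `[-P, P]^d` in the integer lattice. -/
noncomputable def intCube (d : ℕ) (P : ℤ) : Finset (Fin d → ℤ) := Fintype.piFinset fun _ => Finset.Icc (-P) P

lemma mem_intCube {d : ℕ} {P : ℤ} {n : Fin d → ℤ} : n ∈ intCube d P ↔ ∀ i, |n i| ≤ P := by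
  simp [intCube, abs_le]

lemma card_intCube (d P : ℕ) : ((intCube d P).card : ℝ) = (2 * P + 1) ^ d := by
  have : ((P : ℤ) + 1 + P).toNat = 2 * P + 1 := by omega
  simp [intCube, this]

/-- The exponential sum with weight `f` and linear phase `ξ`. -/
noncomputable def linExpSum {d : ℕ} (f : (Fin d → ℤ) → ℝ) (ξ : Fin d → ℝ) : ℂ :=
  ∑' n, (f n : ℂ) * (𝐞 (∑ i, ξ i * (n i : ℝ)) : ℂ)

lemma linExpSum_eq_sum {d : ℕ} {f : (Fin d → ℤ) → ℝ} {P : ℤ} (hf : ∀ n ∉ intCube d P, f n = 0)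
    (ξ : Fin d → ℝ) :
    linExpSum f ξ = ∑ n ∈ intCube d P, (f n : ℂ) * (𝐞 (∑ i, ξ i * (n i : ℝ)) : ℂ) :=
  tsum_eq_sum fun n hn => by simp [hf n hn]

lemma fwdDiff_single_eq_zero {d : ℕ} {f : (Fin d → ℤ) → ℝ} {P : ℤ}
    (hf : ∀ n ∉ intCube d P, f n = 0) (i : Fin d) :
    ∀ n ∉ intCube d (P + 1), fwdDiff (Pi.single i 1) f n = 0 := by
  intro n hn
  rw [fwdDiff, hf, hf, sub_zero]
  · exact fun h => hn (mem_intCube.2 fun j => (mem_intCube.1 h j).trans (by omega))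
  · refine fun h => hn (mem_intCube.2 fun j => ?_)
    have := mem_intCube.1 h j
    rw [Pi.add_apply, Pi.single_apply] at this
    split_ifs at this <;> rw [abs_le] at this ⊢ <;> omega

/-- Summation by parts: shifting the variable by a unit vector multiplies the phase by `𝐞 (ξ i)`. -/
lemma linExpSum_fwdDiff {d : ℕ} {f : (Fin d → ℤ) → ℝ} {P : ℤ} (hf : ∀ n ∉ intCube d P, f n = 0)
    (ξ : Fin d → ℝ) (i : Fin d) :
    ‖linExpSum (fwdDiff (Pi.single i 1) f) ξ‖ = ‖(𝐞 (ξ i) : ℂ) - 1‖ * ‖linExpSum f ξ‖ := by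
  set v : Fin d → ℤ := Pi.single i 1 with hv
  obtain ⟨g, hg⟩ : ∃ g : (Fin d → ℤ) → ℂ,
    ∀ n, g n = (f n : ℂ) * (𝐞 (∑ i, ξ i * (n i : ℝ)) : ℂ) := ⟨_, fun _ => rfl⟩
  have hs : Summable g := summable_of_ne_finset_zero (s := intCube d P) fun n hn => by
    simp [hg, hf n hn]
  have hs' : Summable fun n => g (n + v) := (Equiv.addRight v).summable_iff.2 hs
  have hphase : ∀ n : Fin d → ℤ, (𝐞 (∑ j, ξ j * ((n + v) j : ℝ)) : ℂ)
      = (𝐞 (∑ j, ξ j * (n j : ℝ)) : ℂ) * (𝐞 (ξ i) : ℂ) := by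
    intro n
    have : ∑ j, ξ j * ((n + v) j : ℝ) = ∑ j, ξ j * (n j : ℝ) + ξ i := by
      simp [hv, mul_add, Finset.sum_add_distrib, Pi.single_apply]
    rw [this, AddChar.map_add_eq_mul, Circle.coe_mul]
  have h0 : linExpSum f ξ = ∑' n, g n := tsum_congr fun n => (hg n).symm
  have h1 : ∑' n, g n = ∑' n, g (n + v) := ((Equiv.addRight v).tsum_eq g).symm
  have h2 : (𝐞 (ξ i) : ℂ) * linExpSum (fwdDiff v f) ξ
      = ∑' n, (g (n + v) - (𝐞 (ξ i) : ℂ) * g n) := by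
    rw [linExpSum, ← tsum_mul_left]
    refine tsum_congr fun n => ?_
    rw [hg, hg, hphase, fwdDiff]
    push_cast
    ring
  have hmul : (𝐞 (ξ i) : ℂ) * linExpSum (fwdDiff v f) ξ = (1 - (𝐞 (ξ i) : ℂ)) * linExpSum f ξ := by
    rw [h2, hs'.tsum_sub (hs.mul_left _), ← h1, tsum_mul_left, sub_mul, one_mul, h0]
  have := congrArg norm hmul
  rwa [norm_mul, norm_mul, Circle.norm_coe, one_mul, norm_sub_rev] at this

/-- Sum by parts `k` times, then bound trivially; each difference enlarges the support cube by one.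
-/
lemma norm_linExpSum_mul_pow_le {d : ℕ} (i : Fin d) (ξ : Fin d → ℝ) (B : ℝ) (k P : ℕ)
    (f : (Fin d → ℤ) → ℝ) (hf : ∀ n ∉ intCube d P, f n = 0)
    (hB : ∀ n, ‖(fwdDiff (Pi.single i 1))^[k] f n‖ ≤ B) :
    ‖(𝐞 (ξ i) : ℂ) - 1‖ ^ k * ‖linExpSum f ξ‖ ≤ (2 * (P + k : ℕ) + 1) ^ d * B := by
  induction k generalizing f P with
  | zero =>
    rw [linExpSum_eq_sum hf, pow_zero, one_mul]
    refine (norm_sum_le_of_le _ (f := fun n => _) (n := fun _ => B) fun n _ => ?_).trans ?_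
    · rw [norm_mul, Circle.norm_coe, mul_one, Complex.norm_real]; exact hB n
    · simp [card_intCube]
  | succ k ih =>
    have := ih (P + 1) (fwdDiff (Pi.single i 1) f) (by simpa using fwdDiff_single_eq_zero hf i) hB
    rw [linExpSum_fwdDiff hf] at this
    refine le_trans (le_of_eq (by ring)) (this.trans (le_of_eq ?_))
    rw [show P + 1 + k = P + (k + 1) by ring]

/-! ### Distance to the nearest integer -/

lemma distInt_nonneg (x : ℝ) : 0 ≤ distInt x := abs_nonneg _

lemma distInt_le_abs_sub (x : ℝ) (m : ℤ) : distInt x ≤ |x - m| := round_le x m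

lemma distInt_add_int (x : ℝ) (m : ℤ) : distInt (x + m) = distInt x := by
  simp [distInt]

lemma distInt_le_add (x y : ℝ) : distInt x ≤ distInt (x + y) + |y| := by
  refine (distInt_le_abs_sub x (round (x + y))).trans ?_
  rw [distInt]
  have := abs_sub (x + y - round (x + y)) y
  rwa [show x + y - round (x + y) - y = x - round (x + y) by ring] at this

lemma distInt_of_abs_le_half {x : ℝ} (hx : |x| ≤ 1 / 2) : distInt x = |x| := by
  refine le_antisymm (by simpa using distInt_le_abs_sub x 0) ?_
  rcases eq_or_ne (round x) 0 with h | h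
  · simp [distInt, h]
  · have h1 : (1 : ℝ) ≤ |(round x : ℝ)| := by exact_mod_cast Int.one_le_abs h
    have := abs_sub_abs_le_abs_sub (round x : ℝ) x
    rw [distInt, abs_sub_comm]
    linarith

lemma four_mul_distInt_le (x : ℝ) : 4 * distInt x ≤ ‖(𝐞 x : ℂ) - 1‖ := by
  set y := x - round x with hy
  have hxy : (𝐞 x : ℂ) = 𝐞 y := by
    have : x = y + round x := by ring
    rw [this, AddChar.map_add_eq_mul, Circle.coe_mul]
    have : (𝐞 (round x : ℝ) : ℂ) = 1 := by
      rw [Real.fourierChar_apply]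
      have := Complex.exp_int_mul_two_pi_mul_I (round x)
      rw [← this]; congr 1; push_cast; ring
    simp [this]
  have hy2 : |y| ≤ 1 / 2 := abs_sub_round x
  have hd : distInt x = |y| := rfl
  rw [hxy, hd, Real.fourierChar_apply, mul_comm _ Complex.I, Complex.norm_exp_I_mul_ofReal_sub_one,
    norm_mul, show 2 * Real.pi * y / 2 = Real.pi * y by ring]
  have h2 : 2 / Real.pi * |Real.pi * y| ≤ |Real.sin (Real.pi * y)| := by
    apply Real.mul_abs_le_abs_sin
    rw [abs_mul, abs_of_pos Real.pi_pos]
    nlinarith [Real.pi_pos]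
  rw [abs_mul, abs_of_pos Real.pi_pos, ← mul_assoc, div_mul_cancel₀ _ Real.pi_ne_zero] at h2
  simp only [Real.norm_eq_abs, abs_two]
  linarith

/-! ### Decay of the correlation sums -/

/-- The majorant `1 / (1 + (N‖x‖)²)`. -/
noncomputable def distDecay (N : ℝ) (x : ℝ) : ℝ := 1 / (1 + (N * distInt x) ^ 2)

lemma distDecay_nonneg (N x : ℝ) : 0 ≤ distDecay N x := by unfold distDecay; positivity

lemma distDecay_le_one (N x : ℝ) : distDecay N x ≤ 1 := by
  unfold distDecay
  rw [div_le_one (by positivity)]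
  nlinarith [sq_nonneg (N * distInt x)]

lemma distDecay_add_int (N x : ℝ) (m : ℤ) : distDecay N (x + m) = distDecay N x := by
  simp [distDecay, distInt_add_int]

section
variable {d : ℕ} {η : 𝓢(EuclideanSpace ℝ (Fin d), ℝ)}

lemma cutoffWeight_eq_zero (hη : IsCubeCutoff η) {N : ℕ} (hN : 1 ≤ N) (n : Fin d → ℤ)
    (hn : n ∉ intCube d (2 * N : ℕ)) : cutoffWeight η N n = 0 := by
  simp only [mem_intCube, not_forall, not_le] at hn
  obtain ⟨i, hi⟩ := hn
  refine hη.eq_zero _ ⟨i, ?_⟩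
  have hN' : (0 : ℝ) < N := by exact_mod_cast hN
  simp only [abs_div, Nat.abs_cast]
  rw [lt_div_iff₀ hN']
  exact_mod_cast hi

lemma fwdDiff_iterate_cutoff_mul (N : ℕ) (h : Fin d → ℤ) (i : Fin d) (k : ℕ)
    (n : Fin d → ℤ) :
    (fwdDiff (Pi.single i 1))^[k] (fun n => cutoffWeight η N (n + h) * cutoffWeight η N n) n =
      (fwdDiff (EuclideanSpace.single i (1 / (N : ℝ))))^[k]
        (fun x => η (x + WithLp.toLp 2 fun j => (h j : ℝ) / (N : ℝ)) * η x)
        (WithLp.toLp 2 fun j => (n j : ℝ) / (N : ℝ)) := by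
  have key : ∀ (k : ℕ) (g : EuclideanSpace ℝ (Fin d) → ℝ) (n : Fin d → ℤ),
      (fwdDiff (Pi.single i 1))^[k] (fun n : Fin d → ℤ => g (WithLp.toLp 2 fun j => (n j : ℝ) / (N : ℝ))) n
      = (fwdDiff (EuclideanSpace.single i (1 / (N : ℝ))))^[k] g
        (WithLp.toLp 2 fun j => (n j : ℝ) / (N : ℝ)) := by
    intro k
    induction k with
    | zero => simp
    | succ k ih =>
      intro g n
      rw [Function.iterate_succ_apply, Function.iterate_succ_apply, ← ih]
      refine congrFun (congrArg _ (funext fun m => ?_)) n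
      simp only [fwdDiff]
      congr 2
      refine PiLp.ext fun j => ?_
      by_cases hj : j = i
      · subst hj; simp [add_div]
      · simp [hj]
  rw [← key]
  refine congrFun (congrArg _ (funext fun m => ?_)) n
  simp only [cutoffWeight]
  congr 2
  refine PiLp.ext fun j => ?_
  simp [add_div]

/-- Differencing `2d` times in the single coordinate with the largest `‖ξᵢ‖` already gives the whole
product: that coordinate's factor to the power `d` dominates the product of all `d` factors. -/
lemma exists_norm_linExpSum_cutoff_le (hd : 1 ≤ d) (hη : IsCubeCutoff η) :
    ∃ C : ℝ, 0 < C ∧ ∀ N : ℕ, 1 ≤ N → ∀ (h : Fin d → ℤ) (ξ : Fin d → ℝ),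
      ‖linExpSum (fun n => cutoffWeight η N (n + h) * cutoffWeight η N n) ξ‖
        ≤ C * (N : ℝ) ^ d * ∏ i, distDecay N (ξ i) := by
  obtain ⟨B₀, hB₀, hB₀'⟩ := exists_norm_iteratedFDeriv_mul_translate_le η 0
  obtain ⟨B, hB, hB'⟩ := exists_norm_iteratedFDeriv_mul_translate_le η (2 * d)
  refine ⟨2 ^ d * ((4 * d + 5) ^ d * (B₀ + B)) + 1, by positivity, fun N hN h ξ => ?_⟩
  set f : (Fin d → ℤ) → ℝ := fun n => cutoffWeight η N (n + h) * cutoffWeight η N n with hf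
  set G := ‖linExpSum f ξ‖ with hG
  have hN' : (1 : ℝ) ≤ N := by exact_mod_cast hN
  have hN0 : (0 : ℝ) < N := by linarith
  have hsupp : ∀ n ∉ intCube d (2 * N : ℕ), f n = 0 := fun n hn => by
    simp [hf, cutoffWeight_eq_zero hη hN n hn]
  have hdiff : ∀ (k : ℕ) (A : ℝ), (∀ y x, ‖iteratedFDeriv ℝ k (fun x => η (x + y) * η x) x‖ ≤ A) →
      ∀ i n, ‖(fwdDiff (Pi.single i 1))^[k] f n‖ ≤ A * (1 / (N : ℝ)) ^ k := by
    intro k A hA i n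
    rw [hf, fwdDiff_iterate_cutoff_mul]
    have h1 : ContDiff ℝ k fun x => η (x + WithLp.toLp 2 fun j => (h j : ℝ) / (N : ℝ)) :=
      (η.smooth k).comp (by fun_prop)
    refine (norm_fwdDiff_iterate_le _ A k _ (h1.mul (η.smooth k)) (hA _) _).trans (le_of_eq ?_)
    simp
  -- Side length of the support after `k` differences: `4N + 2k + 1 ≤ (4d + 5)N`, as `N ≥ 1`.
  have hbase : ∀ k : ℕ, k ≤ 2 * d →
      ((2 * (2 * N + k : ℕ) + 1 : ℝ)) ^ d ≤ ((4 * d + 5) * N) ^ d := by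
    intro k hk
    have hk' : (k : ℝ) ≤ 2 * d := by exact_mod_cast hk
    have : (0 : ℝ) ≤ d := by positivity
    gcongr
    push_cast
    nlinarith
  have h0 : ∀ _ : Fin d, G ≤ ((4 * d + 5) * N) ^ d * B₀ := by
    intro i
    have := norm_linExpSum_mul_pow_le i ξ _ 0 (2 * N) f hsupp (hdiff 0 B₀ hB₀' i)
    simp only [pow_zero, one_mul, mul_one] at this
    exact this.trans (mul_le_mul_of_nonneg_right (hbase 0 (by positivity)) hB₀)
  have h2 : ∀ i, G * ((N * distInt (ξ i)) ^ 2) ^ d ≤ ((4 * d + 5) * N) ^ d * B := by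
    intro i
    have := norm_linExpSum_mul_pow_le i ξ _ (2 * d) (2 * N) f hsupp (hdiff (2 * d) B hB' i)
    have h3 : distInt (ξ i) ^ (2 * d) ≤ ‖(𝐞 (ξ i) : ℂ) - 1‖ ^ (2 * d) := by
      have := distInt_nonneg (ξ i)
      gcongr
      linarith [four_mul_distInt_le (ξ i)]
    have h4 : distInt (ξ i) ^ (2 * d) * G ≤ ((4 * d + 5) * N) ^ d * (B * (1 / (N : ℝ)) ^ (2 * d)) :=
      (mul_le_mul_of_nonneg_right h3 (norm_nonneg _)).trans
        (this.trans (mul_le_mul_of_nonneg_right (hbase _ le_rfl) (by positivity)))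
    have h5 := mul_le_mul_of_nonneg_left h4 (by positivity : (0 : ℝ) ≤ (N : ℝ) ^ (2 * d))
    refine le_trans (le_of_eq ?_) (h5.trans (le_of_eq ?_))
    · rw [← pow_mul, mul_pow]; ring
    · rw [one_div, inv_pow]; field_simp
  have hi : ∀ i, G * (1 + (N * distInt (ξ i)) ^ 2) ^ d
      ≤ 2 ^ d * ((4 * d + 5) ^ d * (B₀ + B)) * (N : ℝ) ^ d := by
    intro i
    have hG0 : 0 ≤ G := norm_nonneg _
    have h6 : (1 + (N * distInt (ξ i)) ^ 2) ^ d ≤ 2 ^ d * (1 + ((N * distInt (ξ i)) ^ 2) ^ d) := by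
      refine (add_pow_le zero_le_one (by positivity) d).trans ?_
      rw [one_pow]
      gcongr
      · norm_num
      · omega
    refine (mul_le_mul_of_nonneg_left h6 hG0).trans ?_
    have h7 := add_le_add (h0 i) (h2 i)
    have h8 := mul_le_mul_of_nonneg_left h7 (by positivity : (0 : ℝ) ≤ 2 ^ d)
    refine le_trans (le_of_eq ?_) (h8.trans (le_of_eq ?_))
    · ring
    · rw [mul_pow]; ring
  have hprod : ∏ i, distDecay N (ξ i) = 1 / ∏ i, (1 + (N * distInt (ξ i)) ^ 2) := by
    simp [distDecay, Finset.prod_inv_distrib]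
  rw [hprod, mul_one_div, le_div_iff₀ (Finset.prod_pos fun i _ => by positivity)]
  have : Nonempty (Fin d) := ⟨⟨0, hd⟩⟩
  obtain ⟨i, hmax⟩ := Finite.exists_max fun i => (1 + ((N : ℝ) * distInt (ξ i)) ^ 2)
  have h9 : ∏ j, (1 + ((N : ℝ) * distInt (ξ j)) ^ 2) ≤ (1 + ((N : ℝ) * distInt (ξ i)) ^ 2) ^ d := by
    refine (Finset.prod_le_prod (fun j _ => by positivity) fun j _ => hmax j).trans (le_of_eq ?_)
    simp
  refine (mul_le_mul_of_nonneg_left h9 (norm_nonneg _)).trans ((hi i).trans ?_)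
  have : (0 : ℝ) ≤ (N : ℝ) ^ d := by positivity
  nlinarith
end

/-! ### Sums of the majorant along an arithmetic progression -/

/-- Telescoping: `(1 + x)² ≤ 2(1 + x²)` bounds each term after the first by a difference of
consecutive values of `1/(1 + δk)`, up to the factor `2/δ`. -/
lemma sum_range_inv_one_add_sq_le {δ : ℝ} (hδ : 0 < δ) (n : ℕ) :
    ∑ k ∈ Finset.range n, 1 / (1 + (δ * k) ^ 2) ≤ 1 + 2 / δ := by
  have key : ∀ n : ℕ, ∑ k ∈ Finset.range (n + 1), 1 / (1 + (δ * k) ^ 2)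
      ≤ 1 + 2 / δ * (1 - 1 / (1 + δ * n)) := by
    intro n
    induction n with
    | zero => simp
    | succ n ih =>
      rw [Finset.sum_range_succ]
      have h1 : 1 / (1 + (δ * (n + 1 : ℕ)) ^ 2)
          ≤ 2 / δ * (1 / (1 + δ * n) - 1 / (1 + δ * (n + 1 : ℕ))) := by
        have e : 2 / δ * (1 / (1 + δ * n) - 1 / (1 + δ * (n + 1 : ℕ)))
            = 2 / ((1 + δ * n) * (1 + δ * (n + 1 : ℕ))) := by
          have : 1 + δ * n ≠ 0 := by positivity
          have : 1 + δ * (n + 1 : ℕ) ≠ 0 := by positivity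
          field_simp
          push_cast
          ring
        rw [e, div_le_div_iff₀ (by positivity) (by positivity)]
        push_cast
        have : 0 ≤ δ * n := by positivity
        nlinarith [sq_nonneg (δ * (n + 1) - 1)]
      linarith
  refine (Finset.sum_le_sum_of_subset_of_nonneg (Finset.range_mono n.le_succ)
    fun _ _ _ => by positivity).trans ((key n).trans ?_)
  have : 0 ≤ 2 / δ * (1 / (1 + δ * n)) := by positivity
  linarith

/-- One candidate for `j` on each side of `-y`. -/
lemma card_filter_natFloor_abs_add_le (y : ℝ) (S : Finset ℤ) (k : ℕ) :
    (S.filter fun j : ℤ => ⌊|(j : ℝ) + y|⌋₊ = k).card ≤ 2 := by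
  refine (Finset.card_le_card (t := {⌈(k : ℝ) - y⌉, ⌊-(k : ℝ) - y⌋}) fun j hj => ?_).trans
    Finset.card_le_two
  have hj' := (Finset.mem_filter.1 hj).2
  rw [Nat.floor_eq_iff (abs_nonneg _)] at hj'
  rw [Finset.mem_insert, Finset.mem_singleton]
  rcases le_total 0 ((j : ℝ) + y) with h | h
  · rw [abs_of_nonneg h] at hj'
    left
    symm
    rw [Int.ceil_eq_iff]
    constructor <;> linarith
  · rw [abs_of_nonpos h] at hj'
    right
    symm
    rw [Int.floor_eq_iff]
    constructor <;> linarith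

lemma sum_inv_one_add_sq_le {δ : ℝ} (hδ : 0 < δ) (y : ℝ) (S : Finset ℤ) :
    ∑ j ∈ S, 1 / (1 + (δ * (j + y)) ^ 2) ≤ 2 * (1 + 2 / δ) := by
  set κ : ℤ → ℕ := fun j => ⌊|(j : ℝ) + y|⌋₊ with hκ
  set h : ℕ → ℝ := fun k => 1 / (1 + (δ * k) ^ 2) with hh
  have hpos : ∀ k, 0 ≤ h k := fun k => by simp only [hh]; positivity
  calc ∑ j ∈ S, 1 / (1 + (δ * (j + y)) ^ 2) ≤ ∑ j ∈ S, h (κ j) := by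
        refine Finset.sum_le_sum fun j _ => ?_
        simp only [hh]
        refine one_div_le_one_div_of_le (by positivity) ?_
        rw [mul_pow, mul_pow, ← sq_abs ((j : ℝ) + y)]
        have := Nat.floor_le (abs_nonneg ((j : ℝ) + y))
        gcongr
    _ = ∑ k ∈ S.image κ, (S.filter fun j => κ j = k).card • h k := Finset.sum_comp _ _
    _ ≤ ∑ k ∈ S.image κ, 2 * h k := by
        refine Finset.sum_le_sum fun k _ => ?_
        rw [nsmul_eq_mul]
        refine mul_le_mul_of_nonneg_right ?_ (hpos k)
        exact_mod_cast card_filter_natFloor_abs_add_le y S k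
    _ ≤ ∑ k ∈ Finset.range ((S.image κ).sup id + 1), 2 * h k := by
        refine Finset.sum_le_sum_of_subset_of_nonneg (fun k hk => ?_)
          fun k _ _ => mul_nonneg zero_le_two (hpos k)
        rw [Finset.mem_range, Nat.lt_succ_iff]
        exact Finset.le_sup (f := id) hk
    _ ≤ _ := by
        rw [← Finset.mul_sum]
        exact mul_le_mul_of_nonneg_left (sum_range_inv_one_add_sq_le hδ _) zero_le_two

/-- The points stay within `D` of `x₀`, so only boundedly many integers can be nearest to them; for
each such integer the majorant is a Cauchy-type sum with spacing `N|γ|`. -/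
lemma sum_distDecay_progression_le {N c D : ℝ} (hN : 0 < N)
    (x γ : ℝ) (hγ : γ ≠ 0) (hγN : N * |γ| ≤ c) (S : Finset ℤ)
    (hS : ∀ j ∈ S, |γ * j + x| ≤ D) (x₀ : ℝ) :
    ∑ j ∈ S, distDecay N (x₀ + (γ * j + x)) ≤
      (2 * (⌈D⌉₊ + 1 : ℕ) + 1) * ((2 * c + 4) / (N * |γ|)) := by
  set P : ℕ := ⌈D⌉₊ + 1 with hP
  set δ := N * |γ| with hδ
  have hδ0 : 0 < δ := mul_pos hN (abs_pos.2 hγ)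
  have h1 : ∀ j ∈ S, distDecay N (x₀ + (γ * j + x)) ≤ ∑ m ∈ Finset.Icc (-P : ℤ) P,
      1 / (1 + (δ * (j + (x₀ + x - round x₀ - m) / γ)) ^ 2) := by
    intro j hj
    set y := x₀ + (γ * j + x) with hy
    -- The two rounding errors of at most `1/2` account for the `+ 1` in `P`.
    have hm : round y - round x₀ ∈ Finset.Icc (-P : ℤ) P := by
      have h2 : |((round y - round x₀ : ℤ) : ℝ)| ≤ P := by
        have e : ((round y - round x₀ : ℤ) : ℝ)
          = (x₀ - round x₀) - (y - round y) + (γ * j + x) := by push_cast; rw [hy]; ring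
        have a1 := abs_sub_round x₀
        have a2 := abs_sub_round y
        have a3 := hS j hj
        have a4 := Nat.le_ceil D
        rw [e, hP]
        push_cast
        rw [abs_le] at *
        constructor <;> linarith
      rw [Finset.mem_Icc, ← abs_le]
      exact_mod_cast h2
    refine le_trans (le_of_eq ?_) (Finset.single_le_sum (fun m _ => by positivity) hm)
    have e : j + (x₀ + x - round x₀ - (round y - round x₀ : ℤ)) / γ = (y - round y) / γ := by
      rw [hy]; push_cast; field_simp; ring
    rw [e, distDecay, distInt, mul_pow, mul_pow, hδ, mul_pow, div_pow, sq_abs, sq_abs]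
    field_simp
  refine (Finset.sum_le_sum h1).trans ?_
  rw [Finset.sum_comm]
  refine (Finset.sum_le_card_nsmul _ _ ((2 * c + 4) / δ) fun m _ => ?_).trans (le_of_eq ?_)
  · refine (sum_inv_one_add_sq_le hδ0 _ S).trans ?_
    rw [le_div_iff₀ hδ0]
    have : 2 / δ * δ = 2 := div_mul_cancel₀ _ hδ0.ne'
    nlinarith
  · have : ((P : ℤ) + 1 + P).toNat = 2 * P + 1 := by omega
    simp [this]

/-! ### The one-dimensional counting bound -/

lemma sum_Icc_le_sum_residues {f : ℤ → ℝ} (hf : ∀ l, 0 ≤ f l) {q : ℕ} (hq : 1 ≤ q) (L : ℕ) :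
    ∑ l ∈ Finset.Icc (-L : ℤ) L, f l ≤ ∑ s ∈ Finset.Ico (0 : ℤ) q,
      ∑ j ∈ Finset.Icc (-((L / q + 1 : ℕ) : ℤ)) ((L / q + 1 : ℕ) : ℤ), f (q * j + s) := by
  have hq0 : (0 : ℤ) < q := by exact_mod_cast hq
  rw [← Finset.sum_product']
  set φ : ℤ → ℤ × ℤ := fun l => (l % q, l / q) with hφ
  have hinv : ∀ l, (q : ℤ) * (φ l).2 + (φ l).1 = l := fun l => Int.mul_ediv_add_emod l q
  have hinj : Set.InjOn φ (Finset.Icc (-L : ℤ) L) := fun a _ b _ h => by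
    rw [← hinv a, ← hinv b, h]
  have h1 : ∑ l ∈ Finset.Icc (-L : ℤ) L, f l
      = ∑ p ∈ (Finset.Icc (-L : ℤ) L).image φ, f (q * p.2 + p.1) := by
    rw [Finset.sum_image hinj]
    exact Finset.sum_congr rfl fun l _ => by rw [hinv]
  rw [h1]
  refine Finset.sum_le_sum_of_subset_of_nonneg (fun p hp => ?_) fun _ _ _ => hf _
  obtain ⟨l, hl, rfl⟩ := Finset.mem_image.1 hp
  rw [Finset.mem_Icc] at hl
  simp only [hφ, Finset.mem_product, Finset.mem_Ico, Finset.mem_Icc]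
  refine ⟨⟨Int.emod_nonneg _ hq0.ne', Int.emod_lt_of_pos _ hq0⟩, ?_, ?_⟩
  · rw [Int.le_ediv_iff_mul_le hq0]
    have := Int.lt_mul_ediv_self_add (x := (L : ℤ)) hq0
    push_cast
    nlinarith
  · have := Int.ediv_le_ediv hq0 hl.2
    push_cast
    linarith

/-- Coprimality makes the least absolute residues of `a * s` distinct integers, so the full sum over
`ℤ` applies: `6 = 2(1 + 2/1)`. -/
lemma sum_inv_one_add_sq_residue_le {a : ℤ} {q : ℕ} (ha : Int.gcd a q = 1) :
    ∑ s ∈ Finset.Ico (0 : ℤ) q, 1 / (1 + ((a * s - q * round ((a * s : ℝ) / q) : ℤ) : ℝ) ^ 2)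
      ≤ 6 := by
  set r : ℤ → ℤ := fun s => a * s - q * round ((a * s : ℝ) / q) with hr
  have hinj : Set.InjOn r (Finset.Ico (0 : ℤ) q) := by
    intro s hs t ht h
    simp only [Finset.coe_Ico, Set.mem_Ico] at hs ht
    have h1 : (q : ℤ) ∣ a * (s - t) :=
      ⟨round ((a * s : ℝ) / q) - round ((a * t : ℝ) / q), by simp only [hr] at h; linarith⟩
    have h2 : (q : ℤ) ∣ s - t :=
      IsCoprime.dvd_of_dvd_mul_left (Int.isCoprime_iff_gcd_eq_one.2 (by rwa [Int.gcd_comm])) h1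
    have := Int.eq_zero_of_abs_lt_dvd h2 (by rw [abs_lt]; constructor <;> linarith)
    linarith
  have := sum_inv_one_add_sq_le one_pos 0 ((Finset.Ico (0 : ℤ) q).image r)
  rw [Finset.sum_image hinj] at this
  norm_num at this
  simpa [hr] using this

lemma abs_mul_progression_le {N c₁ c₂ γ : ℝ} {q K L : ℕ} (hN : 0 < N)
    (hc₂ : 0 < c₂) (hq : 1 ≤ q) (hL : (L : ℝ) ≤ K * N) (hqN : q ≤ c₁ * N)
    (hγ : |γ| ≤ c₂ / (q * N)) {s j : ℤ} (hs : s ∈ Finset.Ico (0 : ℤ) q)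
    (hj : j ∈ Finset.Icc (-((L / q + 1 : ℕ) : ℤ)) ((L / q + 1 : ℕ) : ℤ)) :
    |γ * (q * j + s : ℤ)| ≤ c₂ * (K + 2 * c₁) / q := by
  have hq0 : (0 : ℝ) < q := by exact_mod_cast hq
  have h1 : |(q * j + s : ℤ)| ≤ L + 2 * q := by
    rw [Finset.mem_Ico] at hs
    rw [Finset.mem_Icc] at hj
    have h2 : ((L / q : ℕ) : ℤ) * q ≤ L := by exact_mod_cast Nat.div_mul_le_self L q
    push_cast at hj h2
    rw [abs_le]
    constructor <;> nlinarith
  have h2 : |((q * j + s : ℤ) : ℝ)| ≤ (K + 2 * c₁) * N := by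
    have : |((q * j + s : ℤ) : ℝ)| ≤ L + 2 * q := by exact_mod_cast h1
    linarith
  rw [abs_mul]
  calc _ ≤ c₂ / (q * N) * ((K + 2 * c₁) * N) := by gcongr
    _ = _ := by field_simp

lemma card_progression_le {N c₁ : ℝ} {q K L : ℕ} (hq : 1 ≤ q) (hL : (L : ℝ) ≤ K * N)
    (hqN : q ≤ c₁ * N) :
    ((Finset.Icc (-((L / q + 1 : ℕ) : ℤ)) ((L / q + 1 : ℕ) : ℤ)).card : ℝ)
      ≤ (2 * K + 3 * c₁) * (N / q) := by
  have hq0 : (0 : ℝ) < q := by exact_mod_cast hq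
  have h1 : (((L / q + 1 : ℕ) : ℤ) + 1 - -((L / q + 1 : ℕ) : ℤ)).toNat = 2 * (L / q) + 3 := by omega
  rw [Int.card_Icc, h1, mul_div_assoc', le_div_iff₀ hq0]
  have h2 : ((L / q : ℕ) : ℝ) * q ≤ L := by exact_mod_cast Nat.div_mul_le_self L q
  push_cast at h2 ⊢
  nlinarith

/-- `X` bounds the contribution of a single residue class. This gains a factor `1/(1 + r²)` for
class `s`, so summing over all `q` classes costs only a constant; `E` lets `X` absorb the tail term
`q/N`. Both halves of the final minimum are instances. -/
lemma sum_distDecay_le_of_progression_le {N c₁ c₂ E X γ : ℝ} {q K L : ℕ} (hN : 0 < N) (hc₁ : 0 < c₁)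
    (hc₂ : 0 < c₂) (a : ℤ) (hq : 1 ≤ q) (ha : Int.gcd a q = 1) (hL : (L : ℝ) ≤ K * N)
    (hqN : q ≤ c₁ * N) (hγ : |γ| ≤ c₂ / (q * N)) (hX : q / N ≤ E * X)
    (hA : ∀ s ∈ Finset.Ico (0 : ℤ) q,
      ∑ j ∈ Finset.Icc (-((L / q + 1 : ℕ) : ℤ)) ((L / q + 1 : ℕ) : ℤ),
        distDecay N ((a / q + γ) * (q * j + s : ℤ)) ≤ X) :
    ∑ l ∈ Finset.Icc (-L : ℤ) L, distDecay N ((a / q + γ) * l) ≤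
      6 * ((1 + 4 * (c₂ * (K + 2 * c₁)) ^ 2) + 8 * (2 * K + 3 * c₁) * E) * X := by
  set D := c₂ * (K + 2 * c₁) with hD
  have hD0 : 0 ≤ D := by positivity
  set J : Finset ℤ := Finset.Icc (-((L / q + 1 : ℕ) : ℤ)) ((L / q + 1 : ℕ) : ℤ) with hJ
  have hq0 : (0 : ℝ) < q := by exact_mod_cast hq
  have hX0 : 0 ≤ X := le_trans (Finset.sum_nonneg fun j _ => distDecay_nonneg _ _)
    (hA 0 (by simp; omega))
  set r : ℤ → ℤ := fun s => a * s - q * round ((a * s : ℝ) / q) with hr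
  set C := (1 + 4 * D ^ 2) + 8 * (2 * K + 3 * c₁) * E with hC
  have hEX : 0 ≤ E * X := le_trans (by positivity) hX
  have hmain : ∀ s ∈ Finset.Ico (0 : ℤ) q,
      ∑ j ∈ J, distDecay N ((a / q + γ) * (q * j + s : ℤ)) ≤ C * X * (1 / (1 + (r s : ℝ) ^ 2)) := by
    intro s hs
    rw [mul_one_div, le_div_iff₀ (by positivity)]
    have hrs : (r s : ℝ) / q = (a * s : ℝ) / q - round ((a * s : ℝ) / q) := by
      simp only [hr]; push_cast; field_simp
    -- The `γ` part moves the point by at most `D/q`. If `|r| ≤ 2D`, the factor `1 + r²` is bounded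
    -- and `X` suffices; otherwise `‖αl‖ ≥ |r|/(2q)` on the whole class.
    rcases le_or_gt |(r s : ℝ)| (2 * D) with h | h
    · have h1 : (r s : ℝ) ^ 2 ≤ 4 * D ^ 2 := by
        rw [← sq_abs]
        nlinarith [abs_nonneg (r s : ℝ)]
      calc _ ≤ X * (1 + 4 * D ^ 2) :=
            mul_le_mul (hA s hs) (by linarith) (by positivity) hX0
        _ ≤ _ := by
            have : 0 ≤ 8 * (2 * K + 3 * c₁) * (E * X) := by positivity
            rw [hC]; linarith
    · have hr0 : r s ≠ 0 := fun h0 => by rw [h0] at h; simp at h; linarith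
      have hr1 : 1 ≤ |(r s : ℝ)| := by exact_mod_cast Int.one_le_abs hr0
      have hw : ∀ j ∈ J, distDecay N ((a / q + γ) * (q * j + s : ℤ))
          ≤ 4 * q ^ 2 / (N ^ 2 * (r s : ℝ) ^ 2) := by
        intro j hj
        have h1 := abs_mul_progression_le hN hc₂ hq hL hqN hγ hs hj
        have e : (a / q + γ) * (q * j + s : ℤ)
            = ((r s : ℝ) / q + γ * (q * j + s : ℤ)) + (a * j + round ((a * s : ℝ) / q) : ℤ) := by
          rw [hrs]; push_cast; field_simp; ring
        have h2 : distInt ((r s : ℝ) / q) = |(r s : ℝ)| / q := by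
          have : |(r s : ℝ) / q| ≤ 1 / 2 := by rw [hrs]; exact abs_sub_round _
          rw [distInt_of_abs_le_half this, abs_div, Nat.abs_cast]
        have h3 := distInt_le_add ((r s : ℝ) / q) (γ * (q * j + s : ℤ))
        rw [h2] at h3
        have h4 : |(r s : ℝ)| / (2 * q) ≤ distInt ((r s : ℝ) / q + γ * (q * j + s : ℤ)) := by
          have : c₂ * (K + 2 * c₁) / q ≤ |(r s : ℝ)| / (2 * q) := by
            rw [div_le_div_iff₀ hq0 (by positivity)]
            nlinarith
          have : |(r s : ℝ)| / q = 2 * (|(r s : ℝ)| / (2 * q)) := by field_simp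
          linarith
        rw [e, distDecay_add_int, distDecay]
        have h5 : (N * (|(r s : ℝ)| / (2 * q))) ^ 2
            ≤ 1 + (N * distInt ((r s : ℝ) / q + γ * (q * j + s : ℤ))) ^ 2 := by
          have : (N * (|(r s : ℝ)| / (2 * q))) ^ 2
            ≤ (N * distInt ((r s : ℝ) / q + γ * (q * j + s : ℤ))) ^ 2 := by gcongr
          linarith
        refine (one_div_le_one_div_of_le (by positivity) h5).trans (le_of_eq ?_)
        rw [mul_pow, div_pow, sq_abs]
        field_simp
        norm_num
      have hsum := Finset.sum_le_card_nsmul _ _ _ hw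
      rw [nsmul_eq_mul] at hsum
      have hr2 : 1 + (r s : ℝ) ^ 2 ≤ 2 * (r s : ℝ) ^ 2 := by
        rw [← sq_abs]; nlinarith
      have hr3 : (0 : ℝ) < (r s : ℝ) ^ 2 := by positivity
      calc _ ≤ ((2 * K + 3 * c₁) * (N / q) * (4 * q ^ 2 / (N ^ 2 * (r s : ℝ) ^ 2)))
              * (2 * (r s : ℝ) ^ 2) := by
            refine mul_le_mul (hsum.trans ?_) hr2 (by positivity) (by positivity)
            exact mul_le_mul_of_nonneg_right (card_progression_le hq hL hqN) (by positivity)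
        _ = 8 * (2 * K + 3 * c₁) * (q / N) := by field_simp; norm_num
        _ ≤ 8 * (2 * K + 3 * c₁) * (E * X) := by gcongr
        _ ≤ _ := by
            have : 0 ≤ (1 + 4 * D ^ 2) * X := by positivity
            rw [hC]; linarith
  have hC0 : 0 ≤ C * X := by
    have h1 : 0 ≤ 8 * (2 * K + 3 * c₁) * (E * X) := by positivity
    have h2 : 0 ≤ (1 + 4 * D ^ 2) * X := by positivity
    rw [hC]; linarith
  refine (sum_Icc_le_sum_residues (f := fun l => distDecay N ((a / q + γ) * l))
    (fun _ => distDecay_nonneg _ _) hq L).trans ?_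
  refine (Finset.sum_le_sum hmain).trans ?_
  rw [← Finset.mul_sum]
  refine (mul_le_mul_of_nonneg_left (sum_inv_one_add_sq_residue_le ha) hC0).trans (le_of_eq ?_)
  ring

/-- For one residue class, `N/q` counts its terms trivially, while `1/(qN|γ|)` comes from treating
the class as a progression of step `γq`. -/
lemma exists_sum_distDecay_le (K : ℕ) {c₁ c₂ : ℝ} (hc₁ : 0 < c₁) (hc₂ : 0 < c₂) :
    ∃ C : ℝ, 0 < C ∧ ∀ (N : ℕ), 1 ≤ N → ∀ (a : ℤ) (q : ℕ) (γ : ℝ), 1 ≤ q → (q : ℝ) ≤ c₁ * N →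
      Int.gcd a q = 1 → |γ| ≤ c₂ / (q * N) →
      ∑ l ∈ Finset.Icc (-(K * N : ℕ) : ℤ) (K * N : ℕ), distDecay N ((a / q + γ) * l)
        ≤ C * (N / q) ∧
      (γ ≠ 0 → ∑ l ∈ Finset.Icc (-(K * N : ℕ) : ℤ) (K * N : ℕ), distDecay N ((a / q + γ) * l)
        ≤ C * (1 / (q * N * |γ|))) := by
  set D := c₂ * (K + 2 * c₁) with hD
  have hD0 : 0 ≤ D := by positivity
  set A := 2 * K + 3 * c₁ with hA
  set B := (2 * (⌈D⌉₊ + 1 : ℕ) + 1) * (2 * c₂ + 4) with hB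
  have hA0 : 0 < A := by positivity
  have hB0 : 0 < B := by positivity
  refine ⟨6 * ((1 + 4 * D ^ 2) + 8 * A * (c₁ ^ 2 / A)) * A
    + 6 * ((1 + 4 * D ^ 2) + 8 * A * (c₁ * c₂ / B)) * B, by positivity, ?_⟩
  intro N hN a q γ hq hqN ha hγ
  have hN0 : (0 : ℝ) < N := by exact_mod_cast hN
  have hq0 : (0 : ℝ) < q := by exact_mod_cast hq
  have hL : ((K * N : ℕ) : ℝ) ≤ K * N := by push_cast; exact le_rfl
  constructor
  · refine (sum_distDecay_le_of_progression_le (E := c₁ ^ 2 / A) (X := A * (N / q)) hN0 hc₁ hc₂ a hq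
      ha hL hqN hγ ?_ ?_).trans ?_
    · have : c₁ ^ 2 / A * (A * (N / q)) = c₁ ^ 2 * N / q := by field_simp
      rw [this, div_le_div_iff₀ hN0 hq0]
      nlinarith
    · intro s _
      refine (Finset.sum_le_card_nsmul _ _ 1 fun j _ => distDecay_le_one _ _).trans ?_
      rw [nsmul_eq_mul, mul_one]
      exact card_progression_le hq hL hqN
    · rw [add_mul]
      have : 0 ≤ 6 * ((1 + 4 * D ^ 2) + 8 * A * (c₁ * c₂ / B)) * B * (N / q) := by positivity
      linarith
  · intro hγ0
    have hγp : 0 < |γ| := abs_pos.2 hγ0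
    have hγ' : q * N * |γ| ≤ c₂ := by
      rw [le_div_iff₀ (by positivity)] at hγ; linarith
    refine (sum_distDecay_le_of_progression_le (E := c₁ * c₂ / B) (X := B * (1 / (q * N * |γ|))) hN0
      hc₁ hc₂ a hq ha hL hqN hγ ?_ ?_).trans ?_
    · have : c₁ * c₂ / B * (B * (1 / (q * N * |γ|))) = c₁ * c₂ / (q * N * |γ|) := by field_simp
      rw [this, div_le_div_iff₀ hN0 (by positivity)]
      calc q * (q * N * |γ|) ≤ (c₁ * N) * c₂ := by gcongr
        _ = _ := by ring
    · intro s hs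
      have h1 := sum_distDecay_progression_le (c := c₂) (D := D) hN0 (γ * s) (γ * q) (by positivity)
        (by rw [abs_mul, Nat.abs_cast]; linarith)
        (Finset.Icc (-((K * N / q + 1 : ℕ) : ℤ)) ((K * N / q + 1 : ℕ) : ℤ)) (fun j hj => by
          have h2 := abs_mul_progression_le hN0 hc₂ hq hL hqN hγ hs hj
          have e : γ * q * j + γ * s = γ * (q * j + s : ℤ) := by push_cast; ring
          rw [e]
          exact h2.trans (div_le_self hD0 (by exact_mod_cast hq))) (a * s / q)
      refine le_trans (le_of_eq (Finset.sum_congr rfl fun j _ => ?_)) (h1.trans (le_of_eq ?_))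
      · rw [← distDecay_add_int _ ((a : ℝ) * s / q + _) (a * j)]
        congr 1
        push_cast
        field_simp
        ring
      · rw [hB, abs_mul, Nat.abs_cast]
        field_simp
    · rw [add_mul]
      have : 0 ≤ 6 * ((1 + 4 * D ^ 2) + 8 * A * (c₁ ^ 2 / A)) * A * (1 / (q * N * |γ|)) := by
        positivity
      linarith

/-! ### Weyl differencing -/

lemma quadValue_add {d : ℕ} {M : Matrix (Fin d) (Fin d) ℤ} (hM : M.IsSymm) (m h : Fin d → ℤ) :
    quadValue M (m + h) = quadValue M m + quadValue M h + 2 * (m ⬝ᵥ (M *ᵥ h)) := by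
  have : h ⬝ᵥ (M *ᵥ m) = m ⬝ᵥ (M *ᵥ h) := by
    rw [Matrix.dotProduct_mulVec, ← Matrix.mulVec_transpose, hM.eq, dotProduct_comm]
  simp only [quadValue, Matrix.mulVec_add, add_dotProduct, dotProduct_add, this]
  ring

section
variable {d : ℕ} {η : 𝓢(EuclideanSpace ℝ (Fin d), ℝ)}

/-- Expand `conj(F) F` and substitute `n = m + h`: the quadratic part in `m` cancels, leaving a
phase linear in `m`. -/
lemma norm_quadExpSum_sq_le {M : Matrix (Fin d) (Fin d) ℤ} (hM : M.IsSymm) (hη : IsCubeCutoff η)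
    {N : ℕ} (hN : 1 ≤ N) (α : ℝ) (θ : Fin d → ℝ) :
    ‖quadExpSum M η N α θ‖ ^ 2 ≤ ∑ h ∈ intCube d (4 * N : ℕ),
      ‖linExpSum (fun n => cutoffWeight η N (n + h) * cutoffWeight η N n)
        (fun i => α * ((2 * (M *ᵥ h) i : ℤ) : ℝ))‖ := by
  set φ : (Fin d → ℤ) → ℝ := fun n => α * (quadValue M n : ℝ) + ∑ i, θ i * (n i : ℝ) with hφ
  obtain ⟨g, hg⟩ : ∃ g : (Fin d → ℤ) → ℂ, ∀ n, g n = (cutoffWeight η N n : ℂ) * (𝐞 (φ n) : ℂ) :=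
    ⟨_, fun _ => rfl⟩
  have hg0 : ∀ n ∉ intCube d (2 * N : ℕ), g n = 0 := fun n hn => by
    rw [hg, cutoffWeight_eq_zero hη hN n hn, Complex.ofReal_zero, zero_mul]
  have hF : quadExpSum M η N α θ = ∑' n, g n := tsum_congr fun n => by
    rw [hg, Real.fourierChar_apply]
    congr 2
    simp only [hφ]
    push_cast
    ring
  have hF1 : ∑' n, g n = ∑ m ∈ intCube d (2 * N : ℕ), g m := tsum_eq_sum hg0
  have hF2 : ∀ m ∈ intCube d (2 * N : ℕ), ∑' n, g n = ∑ h ∈ intCube d (4 * N : ℕ), g (m + h) := by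
    intro m hm
    rw [← (Equiv.addLeft m).tsum_eq g]
    refine tsum_eq_sum fun h hh => hg0 _ fun hmh => hh (mem_intCube.2 fun i => ?_)
    have h1 := mem_intCube.1 hm i
    have h2 := mem_intCube.1 hmh i
    simp only [Equiv.coe_addLeft, Pi.add_apply] at h2
    rw [abs_le] at *
    push_cast at *
    constructor <;> linarith
  have hcorr : ∀ m h, (starRingEnd ℂ) (g m) * g (m + h) = (𝐞 (φ h) : ℂ) *
      (((cutoffWeight η N (m + h) * cutoffWeight η N m : ℝ) : ℂ) *
        (𝐞 (∑ i, α * ((2 * (M *ᵥ h) i : ℤ) : ℝ) * (m i : ℝ)) : ℂ)) := by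
    intro m h
    have e : φ (m + h) = φ m + (φ h + ∑ i, α * ((2 * (M *ᵥ h) i : ℤ) : ℝ) * (m i : ℝ)) := by
      have e1 : ((m ⬝ᵥ (M *ᵥ h) : ℤ) : ℝ) = ∑ i, (m i : ℝ) * ((M *ᵥ h) i : ℝ) := by
        simp [dotProduct]
      have e2 : ∑ i, α * ((2 * (M *ᵥ h) i : ℤ) : ℝ) * (m i : ℝ)
          = α * (2 * ∑ i, (m i : ℝ) * ((M *ᵥ h) i : ℝ)) := by
        rw [Finset.mul_sum, Finset.mul_sum]
        refine Finset.sum_congr rfl fun i _ => ?_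
        push_cast
        ring
      rw [e2]
      simp only [hφ, quadValue_add hM, Pi.add_apply, Int.cast_add, Int.cast_mul, e1, mul_add,
        Finset.sum_add_distrib]
      push_cast
      ring
    have hconj : (starRingEnd ℂ) (𝐞 (φ m) : ℂ) * (𝐞 (φ m) : ℂ) = 1 := by
      rw [mul_comm, Complex.mul_conj, Complex.normSq_eq_norm_sq, Circle.norm_coe]
      simp
    rw [hg, hg, e]
    generalize ∑ i, α * ((2 * (M *ᵥ h) i : ℤ) : ℝ) * (m i : ℝ) = S
    clear_value φ
    rw [AddChar.map_add_eq_mul, AddChar.map_add_eq_mul, Circle.coe_mul, Circle.coe_mul,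
      map_mul, Complex.conj_ofReal]
    push_cast
    linear_combination (cutoffWeight η N m : ℂ) * (cutoffWeight η N (m + h) : ℂ) * (𝐞 (φ h) : ℂ) *
      (𝐞 S : ℂ) * hconj
  have hsq : (starRingEnd ℂ) (∑' n, g n) * ∑' n, g n = ∑ h ∈ intCube d (4 * N : ℕ),
      (𝐞 (φ h) : ℂ) * linExpSum (fun n => cutoffWeight η N (n + h) * cutoffWeight η N n)
        (fun i => α * ((2 * (M *ᵥ h) i : ℤ) : ℝ)) := by
    conv_lhs => rw [show (starRingEnd ℂ) (∑' n, g n) = _ by rw [hF1, map_sum], Finset.sum_mul]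
    rw [Finset.sum_congr rfl fun m hm => by rw [hF2 m hm, Finset.mul_sum], Finset.sum_comm]
    refine Finset.sum_congr rfl fun h _ => ?_
    rw [linExpSum_eq_sum (P := (2 * N : ℕ)) fun n hn => by
      rw [cutoffWeight_eq_zero hη hN n hn, mul_zero], Finset.mul_sum]
    exact Finset.sum_congr rfl fun m _ => hcorr m h
  have : ‖quadExpSum M η N α θ‖ ^ 2 = ‖(starRingEnd ℂ) (∑' n, g n) * ∑' n, g n‖ := by
    rw [hF, norm_mul, RCLike.norm_conj, sq]
  rw [this, hsq]
  refine norm_sum_le_of_le _ fun h _ => ?_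
  rw [norm_mul, Circle.norm_coe, one_mul]

lemma exists_norm_quadExpSum_sq_le (hd : 1 ≤ d) {M : Matrix (Fin d) (Fin d) ℤ} (hM : M.IsSymm)
    (hdet : M.det ≠ 0) (hη : IsCubeCutoff η) :
    ∃ (C : ℝ) (K : ℕ), 0 < C ∧ ∀ N : ℕ, 1 ≤ N → ∀ (α : ℝ) (θ : Fin d → ℝ),
      ‖quadExpSum M η N α θ‖ ^ 2 ≤ C * (N : ℝ) ^ d *
        (∑ l ∈ Finset.Icc (-(K * N : ℕ) : ℤ) (K * N : ℕ), distDecay N (α * l)) ^ d := by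
  obtain ⟨C, hC, hG⟩ := exists_norm_linExpSum_cutoff_le hd hη
  -- `8 = 2 · 4`: the factor `2` in `2Mh` times the range `4N` of the shifts.
  refine ⟨C, 8 * ∑ i, ∑ j, (M i j).natAbs, hC, fun N hN α θ => ?_⟩
  set K := 8 * ∑ i, ∑ j, (M i j).natAbs with hK
  refine (norm_quadExpSum_sq_le hM hη hN α θ).trans ?_
  refine (Finset.sum_le_sum fun h _ => hG N hN h _).trans ?_
  rw [← Finset.mul_sum]
  refine mul_le_mul_of_nonneg_left ?_ (by positivity)
  set ψ : (Fin d → ℤ) → (Fin d → ℤ) := fun h i => 2 * (M *ᵥ h) i with hψ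
  have hinj : Function.Injective ψ := by
    intro h h' e
    have : M *ᵥ (h - h') = 0 := by
      rw [Matrix.mulVec_sub, sub_eq_zero]
      funext i
      have := congrFun e i
      simp only [hψ] at this
      omega
    exact sub_eq_zero.1 (Matrix.eq_zero_of_mulVec_eq_zero hdet this)
  have hmem : ∀ h ∈ intCube d (4 * N : ℕ), ψ h ∈ intCube d (K * N : ℕ) := by
    intro h hh
    rw [mem_intCube] at hh ⊢
    intro i
    have h1 : |(M *ᵥ h) i| ≤ ∑ j, |M i j| * (4 * N : ℕ) := by
      rw [Matrix.mulVec, dotProduct]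
      refine (Finset.abs_sum_le_sum_abs _ _).trans (Finset.sum_le_sum fun j _ => ?_)
      rw [abs_mul]
      exact mul_le_mul_of_nonneg_left (hh j) (abs_nonneg _)
    have h2 : ∑ j, |M i j| ≤ ∑ i, ∑ j, |M i j| :=
      Finset.single_le_sum (f := fun i => ∑ j, |M i j|)
        (fun i _ => Finset.sum_nonneg fun j _ => abs_nonneg _) (Finset.mem_univ i)
    rw [← Finset.sum_mul] at h1
    have h3 : (0 : ℤ) ≤ (4 * N : ℕ) := by positivity
    have h4 := mul_le_mul_of_nonneg_right h2 h3
    simp only [hψ, abs_mul, abs_two, hK]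
    push_cast [Int.natCast_natAbs] at *
    linarith
  calc ∑ h ∈ intCube d (4 * N : ℕ), ∏ i, distDecay N (α * ((2 * (M *ᵥ h) i : ℤ) : ℝ))
      = ∑ l ∈ (intCube d (4 * N : ℕ)).image ψ, ∏ i, distDecay N (α * (l i : ℝ)) := by
        rw [Finset.sum_image hinj.injOn]
    _ ≤ ∑ l ∈ intCube d (K * N : ℕ), ∏ i, distDecay N (α * (l i : ℝ)) :=
        Finset.sum_le_sum_of_subset_of_nonneg (Finset.image_subset_iff.2 hmem)
          fun _ _ _ => Finset.prod_nonneg fun _ _ => distDecay_nonneg _ _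
    _ = _ := by
        rw [intCube, ← Finset.prod_univ_sum (fun _ => Finset.Icc (-(K * N : ℕ) : ℤ) (K * N : ℕ))
          fun _ (l : ℤ) => distDecay N (α * l)]
        simp

end

/-! ### Conclusion: extracting the square root -/

lemma rpow_neg_half_sq {x : ℝ} (hx : 0 < x) (d : ℕ) : (x ^ (-(d : ℝ) / 2)) ^ 2 = (x ^ d)⁻¹ := by
  rw [← Real.rpow_natCast, ← Real.rpow_mul hx.le, ← Real.rpow_natCast, ← Real.rpow_neg hx.le]
  congr 1
  push_cast
  ring

theorem propositionA2 (d : ℕ) (hd : 1 ≤ d)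
    (M : Matrix (Fin d) (Fin d) ℤ) (hMsymm : M.IsSymm) (hMdet : M.det ≠ 0)
    (η : 𝓢(EuclideanSpace ℝ (Fin d), ℝ)) (hη : IsCubeCutoff η)
    (c₁ c₂ : ℝ) (hc₁ : 0 < c₁) (hc₂ : 0 < c₂) (ε : ℝ) (hε : 0 < ε) :
    ∃ C : ℝ, 0 < C ∧
      ∀ (N : ℕ), 1 ≤ N →
      ∀ (α : ℝ) (a : ℤ) (q : ℕ) (β : ℝ), α = (a : ℝ) / (q : ℝ) + β →
        1 ≤ q → (q : ℝ) ≤ c₁ * (N : ℝ) → Int.gcd a (q : ℤ) = 1 →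
        distInt β ≤ c₂ / ((q : ℝ) * (N : ℝ)) →
        ∀ θ : Fin d → ℝ,
          ‖quadExpSum M η N α θ‖ ≤
            C * (q : ℝ) ^ (-(d : ℝ) / 2 + ε) * arcMin d N (distInt β) := by
  obtain ⟨C, K, hC, hF⟩ := exists_norm_quadExpSum_sq_le hd hMsymm hMdet hη
  obtain ⟨C', hC', hT⟩ := exists_sum_distDecay_le K hc₁ hc₂
  refine ⟨C * C' ^ d + 1, by positivity, ?_⟩
  intro N hN α a q β hα hq hqN ha hβ θ
  set A := C * C' ^ d + 1 with hA
  have hA1 : 1 ≤ A := by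
    have : 0 < C * C' ^ d := by positivity
    linarith
  have hN0 : (0 : ℝ) < N := by exact_mod_cast hN
  have hq0 : (0 : ℝ) < q := by exact_mod_cast hq
  obtain ⟨hT1, hT2⟩ := hT N hN a q (β - round β) hq hqN ha hβ
  -- Since `l` is an integer, `β` matters only modulo 1 and can be replaced by its signed distance
  -- to the nearest integer.
  have hsum : ∑ l ∈ Finset.Icc (-(K * N : ℕ) : ℤ) (K * N : ℕ), distDecay N (α * l)
      = ∑ l ∈ Finset.Icc (-(K * N : ℕ) : ℤ) (K * N : ℕ),
        distDecay N ((a / q + (β - round β)) * l) := by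
    refine Finset.sum_congr rfl fun l _ => ?_
    rw [← distDecay_add_int _ ((a / q + (β - round β)) * l) (round β * l), hα]
    congr 1
    push_cast
    ring
  rw [← hsum] at hT1 hT2
  set T := ∑ l ∈ Finset.Icc (-(K * N : ℕ) : ℤ) (K * N : ℕ), distDecay N (α * l) with hTdef
  have hT0 : 0 ≤ T := Finset.sum_nonneg fun _ _ => distDecay_nonneg _ _
  set Q := (q : ℝ) ^ (-(d : ℝ) / 2) with hQ
  have hQ0 : 0 < Q := Real.rpow_pos_of_pos hq0 _
  -- The pairs used are `X = N/q`, `Y = N^d` and `X = 1/(qN‖β‖)`, `Y = ‖β‖^(-d/2)`. The `+ 1` in `A`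
  -- gives `C * C' ^ d ≤ A ^ 2`, so no root of the constant is needed.
  have hbound : ∀ X Y : ℝ, 0 ≤ Y → T ≤ C' * X → (N : ℝ) ^ d * X ^ d = (Q * Y) ^ 2 →
      ‖quadExpSum M η N α θ‖ ≤ A * Q * Y := by
    intro X Y hY hTX hXY
    refine (pow_le_pow_iff_left₀ (norm_nonneg _) (by positivity) two_ne_zero).1 ?_
    calc _ ≤ C * (N : ℝ) ^ d * T ^ d := hF N hN α θ
      _ ≤ C * (N : ℝ) ^ d * (C' * X) ^ d := by gcongr
      _ = C * C' ^ d * ((N : ℝ) ^ d * X ^ d) := by ring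
      _ = C * C' ^ d * (Q * Y) ^ 2 := by rw [hXY]
      _ ≤ A ^ 2 * (Q * Y) ^ 2 := by gcongr; nlinarith
      _ = _ := by ring
  have hb1 : ‖quadExpSum M η N α θ‖ ≤ A * Q * (N : ℝ) ^ d := by
    refine hbound _ _ (by positivity) hT1 ?_
    rw [mul_pow, hQ, rpow_neg_half_sq hq0, div_pow]
    field_simp
  have hb2 : distInt β ≠ 0 → ‖quadExpSum M η N α θ‖ ≤ A * Q * distInt β ^ (-(d : ℝ) / 2) := by
    intro h
    have hpos : 0 < distInt β := lt_of_le_of_ne (distInt_nonneg β) h.symm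
    refine hbound _ _ (by positivity) (hT2 (abs_ne_zero.1 h)) ?_
    rw [mul_pow, hQ, rpow_neg_half_sq hq0, rpow_neg_half_sq hpos, ← distInt, div_pow, mul_pow,
      mul_pow, one_pow]
    field_simp
  have hmain : ‖quadExpSum M η N α θ‖ ≤ A * Q * arcMin d N (distInt β) := by
    unfold arcMin
    split_ifs with h
    · exact hb1
    · rcases min_choice ((N : ℝ) ^ d) (distInt β ^ (-(d : ℝ) / 2)) with e | e <;> rw [e]
      exacts [hb1, hb2 h]
  have harc : 0 ≤ arcMin d N (distInt β) := by
    unfold arcMin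
    have := distInt_nonneg β
    split_ifs <;> positivity
  refine hmain.trans (mul_le_mul_of_nonneg_right ?_ harc)
  have : Q ≤ (q : ℝ) ^ (-(d : ℝ) / 2 + ε) :=
    Real.rpow_le_rpow_of_exponent_le (by exact_mod_cast hq) (by linarith)
  gcongr
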